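/- Let $q$ be a complex number with $0<|q|<1$. Write $(a;q)_\infty=\prod_{m\ge 0}(1-aq^m)$ and let $$G(q)=\frac{1}{(q;q^5)_\infty(q^4;q^5)_\infty},\qquad H(q)=\frac{1}{(q^2;q^5)_\infty(q^3;q^5)_\infty}$$ be the Rogers–Ramanujan products. Then the four bilateral series below converge absolutely, and $$\sum_{m=-\infty}^{\infty}(-1)^m\frac{q^{(5m^2+3m)/2}}{1-q^{5m+1}}-\sum_{m=-\infty}^{\infty}(-1)^m\frac{q^{(5m^2-3m)/2}}{1-q^{5m-2}}=(q^5;q^5)_\infty^2\,\frac{G^2(q)}{H(q)},$$ $$\sum_{m=-\infty}^{\infty}(-1)^m\frac{q^{(5m^2-m-2)/2}}{1-q^{5m-2}}-\sum_{m=-\infty}^{\infty}(-1)^m\frac{q^{(5m^2+m-2)/2}}{1-q^{5m-1}}=(q^5;q^5)_\infty^2\,\frac{H^2(q)}{G(q)}.$$ -/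

import Mathlib

noncomputable section

/-- The infinite `q`-shifted factorial `(a; q)_∞ = ∏_{m ≥ 0} (1 - a q^m)`. -/
def qPochInf (a q : ℂ) : ℂ := ∏' m : ℕ, (1 - a * q ^ m)

/-- For `|q| < 1` the product defining `(a; q)_∞` converges. -/
theorem qPochInf_multipliable (a : ℂ) {q : ℂ} (hq : ‖q‖ < 1) :
    Multipliable fun m : ℕ => 1 - a * q ^ m := by
  have hs : Summable fun m : ℕ => ‖-(a * q ^ m)‖ := by
    simpa [norm_mul, norm_pow] using
      (summable_geometric_of_lt_one (norm_nonneg q) hq).mul_left ‖a‖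
  simpa [sub_eq_add_neg] using multipliable_one_add_of_summable hs

/-- For `|q| < 1` the number `(a; q)_∞` vanishes only if one of its factors does. -/
theorem qPochInf_ne_zero (a : ℂ) {q : ℂ} (hq : ‖q‖ < 1) (h : ∀ m : ℕ, 1 - a * q ^ m ≠ 0) :
    qPochInf a q ≠ 0 := by
  have hs : Summable fun m : ℕ => ‖-(a * q ^ m)‖ := by
    simpa [norm_mul, norm_pow] using
      (summable_geometric_of_lt_one (norm_nonneg q) hq).mul_left ‖a‖
  have := tprod_one_add_ne_zero_of_summable (f := fun m : ℕ => -(a * q ^ m))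
    (fun m => by simpa [sub_eq_add_neg] using h m) hs
  simpa [qPochInf, sub_eq_add_neg] using this

/-- The Rogers–Ramanujan product `G(q) = 1 / ((q; q⁵)_∞ (q⁴; q⁵)_∞)`. -/
def rrG (q : ℂ) : ℂ := 1 / (qPochInf q (q ^ 5) * qPochInf (q ^ 4) (q ^ 5))

/-- The Rogers–Ramanujan product `H(q) = 1 / ((q²; q⁵)_∞ (q³; q⁵)_∞)`. -/
def rrH (q : ℂ) : ℂ := 1 / (qPochInf (q ^ 2) (q ^ 5) * qPochInf (q ^ 3) (q ^ 5))

/-- The `m`-th term `(-1)^m q^((5m² + a m + b)/2) / (1 - q^(5m + c))` of a bilateral Lambert-type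
series, `m ∈ ℤ`. It is used only where `5m² + a m + b` is even for all `m`, so that the division
of integers in the exponent is exact. -/
def lambertTerm (a b c : ℤ) (q : ℂ) (m : ℤ) : ℂ :=
  (-1) ^ m * q ^ ((5 * m ^ 2 + a * m + b) / 2) / (1 - q ^ (5 * m + c))

end

open Filter Topology Set

/-! ### Holomorphic functions on annuli -/

/-! Put p = q⁵, θ(y) = `thetaProd p y` and m(z, y) = `appellSum p z y`. Everything follows from one
identity, `appellPair_mul_thetaProd`: the combination a·m(1/a, x/a) + m(a, xa) equals x θ(x) θ(a²)
(p;p)_∞³ / (θ(a) θ(xa) θ(x/a)).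

To prove it, multiply the combination by θ(xa) θ(x/a), which removes its poles in an annulus of x.
The product vanishes at x = 1 (`mul_appellSum_inv_self`) and has the same multiplier under x ↦ px as
x θ(x), whose only zero there is x = 1. The quotient is therefore holomorphic and p-invariant, hence
constant by the maximum principle (`eq_of_differentiableOn_annulus_of_periodic`). At x = 1/a only
the residue of one Appell–Lerch series survives, which gives the constant.

The choices (a, x) = (q, q⁻³) and (q², q) yield the two formulas, since θ(q) = (p;p)_∞ / G(q) and
θ(q²) = (p;p)_∞ / H(q). The theta series appearing in the functional equations cancel in pairs, so
the Jacobi triple product is not needed. -/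

theorem isOpen_annulus (r R : ℝ) : IsOpen {x : ℂ | r < ‖x‖ ∧ ‖x‖ < R} :=
  (isOpen_lt continuous_const continuous_norm).inter (isOpen_lt continuous_norm continuous_const)

/-- The annulus is the image under `exp` of a vertical strip, which is convex. -/
theorem isPreconnected_annulus {r : ℝ} (hr : 0 < r) (R : ℝ) :
    IsPreconnected {x : ℂ | r < ‖x‖ ∧ ‖x‖ < R} := by
  rcases le_or_gt R 0 with hR | hR
  · convert isPreconnected_empty
    ext x
    simpa using fun _ => hR.trans (norm_nonneg x)
  have hc : Convex ℝ (Complex.re ⁻¹' Ioo (Real.log r) (Real.log R)) :=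
    (convex_Ioo _ _).linear_preimage Complex.reLm
  convert hc.isPreconnected.image Complex.exp Complex.continuous_exp.continuousOn using 1
  ext x
  simp only [mem_ofPred_eq, mem_image, mem_preimage, mem_Ioo]
  constructor
  · rintro ⟨h1, h2⟩
    have hx : x ≠ 0 := norm_pos_iff.mp (hr.trans h1)
    refine ⟨Complex.log x, ?_, Complex.exp_log hx⟩
    rw [Complex.log_re]
    exact ⟨Real.log_lt_log hr h1, Real.log_lt_log (hr.trans h1) h2⟩
  · rintro ⟨y, ⟨h1, h2⟩, rfl⟩
    rw [Complex.norm_exp]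
    exact ⟨(Real.log_lt_iff_lt_exp hr).mp h1, (Real.lt_log_iff_exp_lt hR).mp h2⟩

/-- A holomorphic function on an annulus that is invariant under `x ↦ p x` is constant, provided
the annulus is wider than one period. -/
theorem eq_of_differentiableOn_annulus_of_periodic {f : ℂ → ℂ} {p : ℂ} {r R : ℝ} (hr : 0 < r)
    (hp0 : p ≠ 0) (hp1 : ‖p‖ < 1) (hrR : r < ‖p‖ * R) (hRr : ‖p‖ ^ 2 * R ≤ r)
    (hf : DifferentiableOn ℂ f {x | r < ‖x‖ ∧ ‖x‖ < R})
    (hper : ∀ x, r < ‖p * x‖ → ‖x‖ < R → f (p * x) = f x) {x y : ℂ}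
    (hx : r < ‖x‖ ∧ ‖x‖ < R) (hy : r < ‖y‖ ∧ ‖y‖ < R) : f x = f y := by
  have hp : 0 < ‖p‖ := norm_pos_iff.mpr hp0
  -- The fundamental annulus ‖p‖s ≤ ‖x‖ ≤ s must lie inside the open one.
  obtain ⟨s, hs1, hs2⟩ : ∃ s, r / ‖p‖ < s ∧ s < R :=
    exists_between (by rwa [div_lt_iff₀ hp, mul_comm])
  rw [div_lt_iff₀ hp, mul_comm] at hs1
  have hs0 : 0 < s := by
    by_contra! h
    nlinarith
  have hR : ‖p‖ * R ≤ s := by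
    by_contra! h
    nlinarith
  set K : Set ℂ := {x | ‖p‖ * s ≤ ‖x‖ ∧ ‖x‖ ≤ s} with hK
  have hKU : K ⊆ {x | r < ‖x‖ ∧ ‖x‖ < R} := fun x hx => ⟨hs1.trans_le hx.1, hx.2.trans_lt hs2⟩
  have hKc : IsCompact K := by
    refine Metric.isCompact_of_isClosed_isBounded
      ((isClosed_le continuous_const continuous_norm).inter
        (isClosed_le continuous_norm continuous_const))
      ((Metric.isBounded_closedBall (x := (0 : ℂ)) (r := s)).subset fun x hx => ?_)
    simpa using hx.2
  have hKn : K.Nonempty := by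
    refine ⟨(s : ℂ), ?_, ?_⟩ <;> simp only [Complex.norm_real, Real.norm_eq_abs, abs_of_pos hs0]
    · nlinarith
    · exact le_rfl
  obtain ⟨c, hcK, hc⟩ := hKc.exists_isMaxOn hKn ((hf.continuousOn.mono hKU).norm)
  -- A single shift by p or 1/p brings any point into `K`, so the maximum over `K` is global and
  -- interior.
  have hmax : IsMaxOn (norm ∘ f) {x | r < ‖x‖ ∧ ‖x‖ < R} c := by
    rintro z ⟨hz1, hz2⟩
    rcases lt_or_ge s ‖z‖ with hz | hz
    · have h1 : ‖p‖ * s < ‖p‖ * ‖z‖ := by gcongr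
      have h2 : ‖p‖ * ‖z‖ < ‖p‖ * R := by gcongr
      have h3 : f (p * z) = f z := hper z (by rw [norm_mul]; linarith) hz2
      simp only [mem_ofPred_eq, Function.comp, ← h3]
      refine hc ?_
      simp only [hK, mem_ofPred_eq, norm_mul]
      exact ⟨h1.le, by linarith⟩
    rcases lt_or_ge ‖z‖ (‖p‖ * s) with hz' | hz'
    · have h0 : p * (z / p) = z := mul_div_cancel₀ z hp0
      have h1 : ‖z / p‖ < s := by rwa [norm_div, div_lt_iff₀ hp, mul_comm]
      have h3 : f z = f (z / p) := by
        conv_lhs => rw [← h0]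
        exact hper _ (by rwa [h0]) (h1.trans hs2)
      simp only [mem_ofPred_eq, Function.comp, h3]
      refine hc ?_
      refine ⟨?_, h1.le⟩
      rw [norm_div, le_div_iff₀ hp]
      nlinarith
    · exact hc ⟨hz', hz⟩
  have := Complex.eqOn_of_isPreconnected_of_isMaxOn_norm (isPreconnected_annulus hr R)
    (isOpen_annulus r R) hf (hKU hcK) hmax
  exact (this hx).trans (this hy).symm

/-! ### The infinite products -/

theorem qPochInf_eq_mul (a : ℂ) {q : ℂ} (hq : ‖q‖ < 1) :
    qPochInf a q = (1 - a) * qPochInf (q * a) q := by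
  have h : (fun m : ℕ => 1 - q * a * q ^ m) = fun m => 1 - a * q ^ (m + 1) := by
    ext m
    ring
  rw [qPochInf, qPochInf, h, tprod_eq_zero_mul' (f := fun m : ℕ => 1 - a * q ^ m)]
  · simp
  · simpa only [h] using qPochInf_multipliable (q * a) hq

theorem qPochInf_ne_zero_of_norm_lt_one {a q : ℂ} (hq : ‖q‖ < 1) (ha : ‖a‖ < 1) :
    qPochInf a q ≠ 0 := by
  refine qPochInf_ne_zero a hq fun m h => ?_
  have h1 : ‖a * q ^ m‖ = 1 := by rw [← sub_eq_zero.mp h, norm_one]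
  rw [norm_mul, norm_pow] at h1
  have := mul_le_of_le_one_right (norm_nonneg a) (pow_le_one₀ (n := m) (norm_nonneg q) hq.le)
  linarith

theorem differentiable_qPochInf {q : ℂ} (hq : ‖q‖ < 1) :
    Differentiable ℂ fun a => qPochInf a q := by
  intro a
  have hball : Metric.ball (0 : ℂ) (‖a‖ + 1) ∈ 𝓝 a :=
    Metric.isOpen_ball.mem_nhds (by simp)
  refine DifferentiableOn.differentiableAt (s := Metric.ball (0 : ℂ) (‖a‖ + 1)) ?_ hball
  have hs := (summable_geometric_of_lt_one (norm_nonneg q) hq).mul_left (‖a‖ + 1)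
  have := hs.hasProdLocallyUniformlyOn_nat_one_add (f := fun m (a : ℂ) => -(a * q ^ m))
    (K := Metric.ball (0 : ℂ) (‖a‖ + 1)) Metric.isOpen_ball
    (.of_forall fun m x hx => by
      rw [norm_neg, norm_mul, norm_pow]
      gcongr
      exact (mem_ball_zero_iff.mp hx).le)
    (fun m => by fun_prop)
  have h2 := this.differentiableOn (.of_forall fun s => by
    simpa [Finset.prod_fn] using DifferentiableOn.finsetProd (fun _ _ => by fun_prop))
    Metric.isOpen_ball
  simpa only [qPochInf, sub_eq_add_neg] using h2

/-! ### Theta products -/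

noncomputable section

/-- The theta product `(p; p)_∞ (y; p)_∞ (p/y; p)_∞` without its factor `1 - y`. -/
def thetaReg (p y : ℂ) : ℂ := qPochInf p p * qPochInf (p * y) p * qPochInf (p * y⁻¹) p

/-- The theta product `(p; p)_∞ (y; p)_∞ (p/y; p)_∞`. -/
def thetaProd (p y : ℂ) : ℂ := (1 - y) * thetaReg p y

end

theorem thetaReg_inv (p y : ℂ) : thetaReg p y⁻¹ = thetaReg p y := by
  simp only [thetaReg, inv_inv]
  ring

theorem thetaReg_one (p : ℂ) : thetaReg p 1 = qPochInf p p ^ 3 := by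
  simp only [thetaReg, inv_one, mul_one]
  ring

theorem thetaProd_one (p : ℂ) : thetaProd p 1 = 0 := by simp [thetaProd]

theorem thetaProd_inv (p : ℂ) {y : ℂ} (hy : y ≠ 0) : thetaProd p y⁻¹ = -y⁻¹ * thetaProd p y := by
  rw [thetaProd, thetaProd, thetaReg_inv]
  field_simp
  ring

theorem thetaProd_eq {p : ℂ} (hp : ‖p‖ < 1) (y : ℂ) :
    thetaProd p y = qPochInf p p * qPochInf y p * qPochInf (p * y⁻¹) p := by
  rw [thetaProd, thetaReg, qPochInf_eq_mul y hp]
  ring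

theorem thetaProd_mul {p y : ℂ} (hp0 : p ≠ 0) (hp : ‖p‖ < 1) (hy : y ≠ 0) :
    thetaProd p (p * y) = -y⁻¹ * thetaProd p y := by
  have h : p * (p * y)⁻¹ = y⁻¹ := by field_simp
  rw [thetaProd_eq hp, h, qPochInf_eq_mul y⁻¹ hp, thetaProd, thetaReg]
  field_simp
  ring

theorem thetaProd_mul_inv {p y : ℂ} (hp0 : p ≠ 0) (hp : ‖p‖ < 1) (hy : y ≠ 0) :
    thetaProd p (p * y⁻¹) = thetaProd p y := by
  rw [thetaProd_mul hp0 hp (inv_ne_zero hy), thetaProd_inv p hy, inv_inv]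
  field_simp

/-- Within ‖p‖ < ‖y‖ < 1/‖p‖ the theta product can vanish only through the factor 1 - y. -/
theorem thetaReg_ne_zero {p y : ℂ} (hp : ‖p‖ < 1) (h1 : ‖p‖ < ‖y‖) (h2 : ‖p‖ * ‖y‖ < 1) :
    thetaReg p y ≠ 0 := by
  refine mul_ne_zero (mul_ne_zero ?_ ?_) ?_ <;> refine qPochInf_ne_zero_of_norm_lt_one hp ?_
  · exact hp
  · rwa [norm_mul]
  · rw [norm_mul, norm_inv, ← div_eq_mul_inv, div_lt_one ((norm_nonneg p).trans_lt h1)]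
    exact h1

theorem thetaProd_ne_zero {p y : ℂ} (hp : ‖p‖ < 1) (h1 : ‖p‖ < ‖y‖) (h2 : ‖p‖ * ‖y‖ < 1)
    (hy : y ≠ 1) : thetaProd p y ≠ 0 :=
  mul_ne_zero (sub_ne_zero.mpr hy.symm) (thetaReg_ne_zero hp h1 h2)

theorem differentiableAt_thetaReg {p y : ℂ} (hp : ‖p‖ < 1) (hy : y ≠ 0) :
    DifferentiableAt ℂ (thetaReg p) y := by
  have h := differentiable_qPochInf hp
  have h1 : DifferentiableAt ℂ (fun y => qPochInf (p * y) p) y :=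
    (h (p * y)).comp (f := fun y => p * y) y (by fun_prop)
  have h2 : DifferentiableAt ℂ (fun y => qPochInf (p * y⁻¹) p) y :=
    (h (p * y⁻¹)).comp (f := fun y => p * y⁻¹) y (by fun_prop (disch := assumption))
  exact (h1.const_mul _).mul h2

theorem differentiableAt_thetaProd {p y : ℂ} (hp : ‖p‖ < 1) (hy : y ≠ 0) :
    DifferentiableAt ℂ (thetaProd p) y :=
  (by fun_prop : DifferentiableAt ℂ (fun y : ℂ => 1 - y) y).mul (differentiableAt_thetaReg hp hy)

noncomputable section

/-- The `r`-th term `(-1)^r p^(r(r-1)/2) z^r` of a theta series, `r ∈ ℤ`. -/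
def thetaTerm (p z : ℂ) (r : ℤ) : ℂ := (-1) ^ r * p ^ (r * (r - 1) / 2) * z ^ r

/-- The `r`-th term `(-1)^r p^(r(r-1)/2) z^r / (1 - p^r y)` of an Appell–Lerch series, `r ∈ ℤ`. -/
def appellTerm (p z y : ℂ) (r : ℤ) : ℂ := thetaTerm p z r / (1 - p ^ r * y)

/-- The Appell–Lerch series `∑ (-1)^r p^(r(r-1)/2) z^r / (1 - p^r y)` over `r ∈ ℤ`. -/
def appellSum (p z y : ℂ) : ℂ := ∑' r : ℤ, appellTerm p z y r

end

/-! ### Theta terms -/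

theorem thetaTerm_zero (p z : ℂ) : thetaTerm p z 0 = 1 := by simp [thetaTerm]

theorem thetaTerm_ne_zero {p z : ℂ} (hp : p ≠ 0) (hz : z ≠ 0) (r : ℤ) : thetaTerm p z r ≠ 0 := by
  simp [thetaTerm, zpow_ne_zero, hp, hz]

theorem thetaTerm_add_one {p z : ℂ} (hp : p ≠ 0) (hz : z ≠ 0) (r : ℤ) :
    thetaTerm p z (r + 1) = -z * p ^ r * thetaTerm p z r := by
  obtain ⟨k, hk⟩ := Int.even_mul_pred_self r
  have h1 : r * (r - 1) / 2 = k := by omega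
  have h2 : (r + 1) * (r + 1 - 1) / 2 = k + r := by
    have : (r + 1) * (r + 1 - 1) = r * (r - 1) + 2 * r := by ring
    omega
  rw [thetaTerm, thetaTerm, h1, h2, zpow_add₀ hp, zpow_add_one₀ hz, zpow_add_one₀ (by norm_num)]
  ring

theorem thetaTerm_mul {p z : ℂ} (hp : p ≠ 0) (hz : z ≠ 0) (r : ℤ) :
    thetaTerm p (p * z) r = -z⁻¹ * thetaTerm p z (r + 1) := by
  rw [thetaTerm_add_one hp hz, thetaTerm, thetaTerm, mul_zpow]
  field_simp

theorem thetaTerm_inv_neg {p : ℂ} (hp : p ≠ 0) (z : ℂ) (r : ℤ) :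
    thetaTerm p z⁻¹ (-r) = p ^ r * thetaTerm p z r := by
  obtain ⟨k, hk⟩ := Int.even_mul_pred_self r
  have h1 : r * (r - 1) / 2 = k := by omega
  have h2 : -r * (-r - 1) / 2 = k + r := by
    have : -r * (-r - 1) = r * (r - 1) + 2 * r := by ring
    omega
  have h3 : ((-1 : ℂ)) ^ (-r) = (-1) ^ r := by
    rw [zpow_neg, ← inv_zpow]
    norm_num
  rw [thetaTerm, thetaTerm, h1, h2, zpow_add₀ hp, h3, inv_zpow, zpow_neg, inv_inv]
  ring

theorem summable_thetaTerm_nat {p z : ℂ} (hp0 : p ≠ 0) (hp : ‖p‖ < 1) (hz : z ≠ 0) :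
    Summable fun n : ℕ => thetaTerm p z n := by
  refine summable_of_ratio_test_tendsto_lt_one zero_lt_one
    (.of_forall fun n => thetaTerm_ne_zero hp0 hz n) ?_
  have h : Tendsto (fun n : ℕ => ‖z‖ * ‖p‖ ^ n) atTop (𝓝 (‖z‖ * 0)) :=
    (tendsto_pow_atTop_nhds_zero_of_lt_one (norm_nonneg p) hp).const_mul _
  rw [mul_zero] at h
  refine h.congr fun n => ?_
  have := norm_ne_zero_iff.mpr (thetaTerm_ne_zero hp0 hz n)
  push_cast
  rw [thetaTerm_add_one hp0 hz, norm_mul, norm_mul, norm_neg, mul_div_assoc, div_self this,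
    mul_one, zpow_natCast, norm_pow]

theorem summable_thetaTerm {p z : ℂ} (hp0 : p ≠ 0) (hp : ‖p‖ < 1) (hz : z ≠ 0) :
    Summable (thetaTerm p z) := by
  refine Summable.of_nat_of_neg_add_one (summable_thetaTerm_nat hp0 hp hz) ?_
  -- The term at -(n + 1) is -z times the term at n + 2 of the series for 1/z.
  have h := (summable_nat_add_iff 2).mpr (summable_thetaTerm_nat hp0 hp (inv_ne_zero hz))
  refine (h.mul_left (-z)).congr fun n => ?_
  have h1 := thetaTerm_inv_neg hp0 z⁻¹ (n + 1 : ℤ)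
  have h2 := thetaTerm_add_one hp0 (inv_ne_zero hz) (n + 1 : ℤ)
  rw [inv_inv] at h1
  rw [h1]
  push_cast
  rw [show (n : ℤ) + 2 = n + 1 + 1 by ring, h2]
  field_simp

/-! ### Convergence and holomorphy of Appell–Lerch series -/

/-- For r ≠ 0 the number p^r y has norm at most ρ or at least 1/ρ. The bound is uniform in r and y,
as the Weierstrass test requires. -/
theorem le_norm_one_sub_zpow_mul {p y : ℂ} {ρ : ℝ} (hp0 : p ≠ 0) (hp : ‖p‖ < 1) (hρ0 : 0 < ρ)
    (hρ : ρ < 1) (h1 : ‖p‖ ≤ ρ * ‖y‖) (h2 : ‖p‖ * ‖y‖ ≤ ρ) {r : ℤ} (hr : r ≠ 0) :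
    1 - ρ ≤ ‖1 - p ^ r * y‖ := by
  have hpp : 0 < ‖p‖ := norm_pos_iff.mpr hp0
  rcases lt_or_gt_of_ne hr with hr | hr
  · have h3 : ‖p‖⁻¹ ≤ ‖p‖ ^ r := by
      rw [← zpow_neg_one]
      exact zpow_right_anti₀ hpp hp.le (by omega)
    have h4 : ρ⁻¹ ≤ ‖p ^ r * y‖ := by
      rw [norm_mul, norm_zpow]
      refine le_trans ?_ (mul_le_mul_of_nonneg_right h3 (norm_nonneg y))
      rw [inv_mul_eq_div, le_div_iff₀ hpp, inv_mul_le_iff₀ hρ0]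
      exact h1
    -- This is ρ + 1/ρ ≥ 2.
    have h5 : 2 - ρ ≤ ρ⁻¹ := by
      rw [le_inv_comm₀ (by linarith) hρ0, inv_eq_one_div, le_div_iff₀ (by linarith)]
      nlinarith [sq_nonneg (1 - ρ)]
    have h6 := norm_sub_norm_le (p ^ r * y) 1
    rw [norm_one, norm_sub_rev] at h6
    linarith
  · have h3 : ‖p‖ ^ r ≤ ‖p‖ := by
      conv_rhs => rw [← zpow_one ‖p‖]
      exact zpow_right_anti₀ hpp hp.le (by omega)
    have h4 : ‖p ^ r * y‖ ≤ ρ := by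
      rw [norm_mul, norm_zpow]
      exact (mul_le_mul_of_nonneg_right h3 (norm_nonneg y)).trans h2
    have h6 := norm_sub_norm_le 1 (p ^ r * y)
    rw [norm_one] at h6
    linarith

theorem norm_appellTerm_le {p y : ℂ} (z : ℂ) {ρ : ℝ} (hp0 : p ≠ 0) (hp : ‖p‖ < 1) (hρ0 : 0 < ρ)
    (hρ : ρ < 1) (h1 : ‖p‖ ≤ ρ * ‖y‖) (h2 : ‖p‖ * ‖y‖ ≤ ρ) {r : ℤ} (hr : r ≠ 0) :
    ‖appellTerm p z y r‖ ≤ ‖thetaTerm p z r‖ / (1 - ρ) := by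
  have := le_norm_one_sub_zpow_mul hp0 hp hρ0 hρ h1 h2 hr
  rw [appellTerm, norm_div]
  gcongr

theorem exists_annulus_parameter {p y : ℂ} (hp0 : p ≠ 0) (h1 : ‖p‖ < ‖y‖) (h2 : ‖p‖ * ‖y‖ < 1) :
    ∃ ρ : ℝ, 0 < ρ ∧ ρ < 1 ∧ ‖p‖ < ρ * ‖y‖ ∧ ‖p‖ * ‖y‖ < ρ := by
  have hpp : 0 < ‖p‖ := norm_pos_iff.mpr hp0
  have hy : 0 < ‖y‖ := hpp.trans h1
  obtain ⟨ρ, h3, h4⟩ := exists_between (max_lt ((div_lt_one hy).mpr h1) h2)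
  rw [max_lt_iff, div_lt_iff₀ hy] at h3
  exact ⟨ρ, (mul_pos hpp hy).trans h3.2, h4, h3.1, h3.2⟩

theorem summable_appellTerm {p z y : ℂ} (hp0 : p ≠ 0) (hp : ‖p‖ < 1) (hz : z ≠ 0)
    (h1 : ‖p‖ < ‖y‖) (h2 : ‖p‖ * ‖y‖ < 1) : Summable (appellTerm p z y) := by
  obtain ⟨ρ, hρ0, hρ, h3, h4⟩ := exists_annulus_parameter hp0 h1 h2
  refine Summable.of_norm_bounded_eventually
    ((summable_thetaTerm hp0 hp hz).norm.div_const (1 - ρ)) ?_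
  filter_upwards [(Set.finite_singleton (0 : ℤ)).compl_mem_cofinite] with r hr
  exact norm_appellTerm_le z hp0 hp hρ0 hρ h3.le h4.le hr

/-- Only the term r = 0 has a pole in the annulus. At y = 1 that term and `(1 - y)⁻¹` are both 0 by
convention, so y ≠ 1 need not be assumed. -/
theorem appellSum_sub {p z y : ℂ} (hp0 : p ≠ 0) (hp : ‖p‖ < 1) (hz : z ≠ 0)
    (h1 : ‖p‖ < ‖y‖) (h2 : ‖p‖ * ‖y‖ < 1) :
    appellSum p z y - (1 - y)⁻¹ = ∑' r : ℤ, if r = 0 then 0 else appellTerm p z y r := by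
  rw [appellSum, (summable_appellTerm hp0 hp hz h1 h2).tsum_eq_add_tsum_ite 0, appellTerm,
    thetaTerm_zero]
  simp

theorem differentiableAt_appellSum_sub {p z y : ℂ} (hp0 : p ≠ 0) (hp : ‖p‖ < 1) (hz : z ≠ 0)
    (h1 : ‖p‖ < ‖y‖) (h2 : ‖p‖ * ‖y‖ < 1) :
    DifferentiableAt ℂ (fun y => appellSum p z y - (1 - y)⁻¹) y := by
  obtain ⟨ρ, hρ0, hρ, h3, h4⟩ := exists_annulus_parameter hp0 h1 h2
  set V : Set ℂ := {y | ‖p‖ < ρ * ‖y‖ ∧ ‖p‖ * ‖y‖ < ρ} with hV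
  have hVo : IsOpen V :=
    (isOpen_lt continuous_const (continuous_const.mul continuous_norm)).inter
      (isOpen_lt (continuous_const.mul continuous_norm) continuous_const)
  have hd : DifferentiableOn ℂ (fun y => ∑' r : ℤ, if r = 0 then 0 else appellTerm p z y r) V := by
    refine Complex.differentiableOn_tsum_of_summable_norm
      ((summable_thetaTerm hp0 hp hz).norm.div_const (1 - ρ)) (fun r => ?_) hVo fun r w hw => ?_
    · split_ifs with hr
      · exact differentiableOn_const _
      · intro w hw
        have h5 : 1 - p ^ r * w ≠ 0 := norm_pos_iff.mp
          ((sub_pos.mpr hρ).trans_le (le_norm_one_sub_zpow_mul hp0 hp hρ0 hρ hw.1.le hw.2.le hr))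
        unfold appellTerm
        exact (by fun_prop (disch := assumption) : DifferentiableAt ℂ
          (fun w => thetaTerm p z r / (1 - p ^ r * w)) w).differentiableWithinAt
    · split_ifs with hr
      · rw [norm_zero]
        exact div_nonneg (norm_nonneg _) (sub_pos.mpr hρ).le
      · exact norm_appellTerm_le z hp0 hp hρ0 hρ hw.1.le hw.2.le hr
  refine (hd.congr fun w hw => appellSum_sub hp0 hp hz ?_ ?_).differentiableAt
    (hVo.mem_nhds ⟨h3, h4⟩)
  · nlinarith [hw.1, norm_nonneg w]
  · exact hw.2.trans hρ

/-! ### Functional equations of Appell–Lerch series -/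

theorem one_sub_zpow_mul_ne_zero {p y : ℂ} (hp0 : p ≠ 0) (hp : ‖p‖ < 1) (h1 : ‖p‖ < ‖y‖)
    (h2 : ‖p‖ * ‖y‖ < 1) (hy : y ≠ 1) (r : ℤ) : 1 - p ^ r * y ≠ 0 := by
  rcases eq_or_ne r 0 with rfl | hr
  · simpa [sub_eq_zero] using hy.symm
  · obtain ⟨ρ, hρ0, hρ, h3, h4⟩ := exists_annulus_parameter hp0 h1 h2
    exact norm_pos_iff.mp ((sub_pos.mpr hρ).trans_le
      (le_norm_one_sub_zpow_mul hp0 hp hρ0 hρ h3.le h4.le hr))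

theorem appellSum_mul_mul {p z : ℂ} (hp : p ≠ 0) (hz : z ≠ 0) (y : ℂ) :
    appellSum p (p * z) (p * y) = -z⁻¹ * appellSum p z y := by
  rw [appellSum, appellSum, ← (Equiv.addRight (1 : ℤ)).tsum_eq (appellTerm p z y), ← tsum_mul_left]
  refine tsum_congr fun r => ?_
  simp only [Equiv.coe_addRight]
  rw [appellTerm, appellTerm, thetaTerm_mul hp hz, zpow_add_one₀ hp, mul_assoc (p ^ r), mul_div_assoc]

/-- Termwise this is 1/(1 - u) = 1 + u/(1 - u) with u = p^r y; the factor p^r turns z into pz. -/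
theorem appellSum_eq_tsum_add {p z y : ℂ} (hp0 : p ≠ 0) (hp : ‖p‖ < 1) (hz : z ≠ 0)
    (h1 : ‖p‖ < ‖y‖) (h2 : ‖p‖ * ‖y‖ < 1) (hy : y ≠ 1) :
    appellSum p z y = ∑' r, thetaTerm p z r + y * appellSum p (p * z) y := by
  have hs := summable_appellTerm hp0 hp (mul_ne_zero hp0 hz) h1 h2
  rw [appellSum, appellSum, ← tsum_mul_left,
    ← (summable_thetaTerm hp0 hp hz).tsum_add (hs.mul_left _)]
  refine tsum_congr fun r => ?_
  have hne := one_sub_zpow_mul_ne_zero hp0 hp h1 h2 hy r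
  rw [appellTerm, appellTerm, thetaTerm_mul hp0 hz, thetaTerm_add_one hp0 hz]
  generalize p ^ r = P at hne ⊢
  field_simp
  ring

theorem appellSum_mul_right {p z y : ℂ} (hp0 : p ≠ 0) (hp : ‖p‖ < 1) (hz : z ≠ 0)
    (h1 : 1 < ‖y‖) (h2 : ‖p‖ * ‖y‖ < 1) :
    appellSum p z (p * y) = ∑' r, thetaTerm p z r - p * y * z⁻¹ * appellSum p z y := by
  have h3 : ‖p * y‖ < 1 := by rwa [norm_mul]
  have h4 : p * y ≠ 1 := by
    intro h
    rw [h, norm_one] at h3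
    exact h3.false
  rw [appellSum_eq_tsum_add hp0 hp hz _ _ h4, appellSum_mul_mul hp0 hz]
  · ring
  · rw [norm_mul]
    exact lt_mul_of_one_lt_right (norm_pos_iff.mpr hp0) h1
  · exact mul_lt_one_of_nonneg_of_lt_one_left (norm_nonneg p) hp h3.le

/-- This makes the two theta series cancel in the functional equation of `appellPair`. -/
theorem tsum_thetaTerm_inv {p z : ℂ} (hp : p ≠ 0) (hz : z ≠ 0) :
    z * ∑' r, thetaTerm p z⁻¹ r = -∑' r, thetaTerm p z r := by
  rw [← (Equiv.neg ℤ).tsum_eq (thetaTerm p z⁻¹), ← (Equiv.addRight (1 : ℤ)).tsum_eq (thetaTerm p z),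
    ← tsum_mul_left, ← tsum_neg]
  refine tsum_congr fun r => ?_
  simp only [Equiv.neg_apply, Equiv.coe_addRight]
  rw [thetaTerm_inv_neg hp z, thetaTerm_add_one hp hz]
  ring

theorem reflection_identity {P a T : ℂ} (ha : a ≠ 0) (hP : P ≠ 0) (h : 1 - P * a ≠ 0) :
    a * (P * T / (1 - P⁻¹ * a⁻¹)) + T / (1 - P * a) = T - -a * P * T := by
  have h7 : 1 - P⁻¹ * a⁻¹ = -(1 - P * a) / (P * a) := by
    field_simp
    ring
  rw [h7, div_div_eq_mul_div, div_neg, mul_neg, mul_div_assoc', neg_add_eq_sub, ← sub_div,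
    div_eq_iff h]
  ring

/-- Pairing index -r on the left with r on the right cancels the denominators and leaves a theta
series minus its shift by one, which sums to 0. -/
theorem mul_appellSum_inv_self {p a : ℂ} (hp0 : p ≠ 0) (hp : ‖p‖ < 1) (h1 : ‖p‖ < ‖a‖)
    (h2 : ‖a‖ < 1) : a * appellSum p a⁻¹ a⁻¹ = -appellSum p a a := by
  have ha : a ≠ 0 := norm_pos_iff.mp ((norm_nonneg p).trans_lt h1)
  have ha1 : a ≠ 1 := by
    rintro rfl
    simp at h2
  have h3 : ‖p‖ * ‖a‖ < 1 := mul_lt_one_of_nonneg_of_lt_one_left (norm_nonneg p) hp h2.le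
  have hi1 : ‖p‖ < ‖a⁻¹‖ := by
    rw [norm_inv]
    exact hp.trans ((one_lt_inv₀ (norm_pos_iff.mpr ha)).mpr h2)
  have hi2 : ‖p‖ * ‖a⁻¹‖ < 1 := by
    rwa [norm_inv, ← div_eq_mul_inv, div_lt_one (norm_pos_iff.mpr ha)]
  have hs := summable_appellTerm hp0 hp ha h1 h3
  have hs' : Summable fun r : ℤ => appellTerm p a⁻¹ a⁻¹ (-r) :=
    (Equiv.neg ℤ).summable_iff (f := appellTerm p a⁻¹ a⁻¹) |>.mpr (summable_appellTerm hp0 hp (inv_ne_zero ha) hi1 hi2)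
  have ht := summable_thetaTerm hp0 hp ha
  have ht' : Summable fun r : ℤ => thetaTerm p a (r + 1) :=
    ((Equiv.addRight (1 : ℤ)).summable_iff (f := thetaTerm p a)).mpr ht
  rw [← sub_eq_zero, sub_neg_eq_add]
  have h4 : appellSum p a⁻¹ a⁻¹ = ∑' r : ℤ, appellTerm p a⁻¹ a⁻¹ (-r) :=
    ((Equiv.neg ℤ).tsum_eq (appellTerm p a⁻¹ a⁻¹)).symm
  have h5 : ∑' r : ℤ, thetaTerm p a (r + 1) = ∑' r, thetaTerm p a r :=
    (Equiv.addRight (1 : ℤ)).tsum_eq (thetaTerm p a)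
  have h6 : ∑' r : ℤ, (thetaTerm p a r - thetaTerm p a (r + 1)) = 0 := by
    rw [ht.tsum_sub ht', h5, sub_self]
  rw [h4, appellSum, ← tsum_mul_left, ← (hs'.mul_left a).tsum_add hs]
  refine Eq.trans ?_ h6
  refine tsum_congr fun r => ?_
  have hne := one_sub_zpow_mul_ne_zero hp0 hp h1 h3 ha1 r
  have hpr := zpow_ne_zero r hp0
  rw [appellTerm, appellTerm, thetaTerm_inv_neg hp0 a, thetaTerm_add_one hp0 ha, zpow_neg]
  exact reflection_identity ha hpr hne

/-! ### Two Appell–Lerch series as a theta quotient -/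

noncomputable section

/-- The holomorphic continuation of `thetaProd p y * appellSum p z y` to `y = 1`. -/
def thetaAppell (p z y : ℂ) : ℂ :=
  thetaReg p y + thetaProd p y * (appellSum p z y - (1 - y)⁻¹)

/-- The combination of two Appell–Lerch series that is a theta quotient in `x`. -/
def appellPair (p a x : ℂ) : ℂ := a * appellSum p a⁻¹ (x * a⁻¹) + appellSum p a (x * a)

/-- The holomorphic continuation of `thetaProd p (x a) * thetaProd p (x / a) * appellPair p a x`
to `x = a` and `x = 1 / a`. -/
def thetaAppellPair (p a x : ℂ) : ℂ :=
  a * thetaProd p (x * a) * thetaAppell p a⁻¹ (x * a⁻¹) +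
    thetaProd p (x * a⁻¹) * thetaAppell p a (x * a)

end

theorem thetaAppell_one (p z : ℂ) : thetaAppell p z 1 = qPochInf p p ^ 3 := by
  simp [thetaAppell, thetaProd_one, thetaReg_one]

theorem thetaAppell_of_ne_one (p z : ℂ) {y : ℂ} (hy : y ≠ 1) :
    thetaAppell p z y = thetaProd p y * appellSum p z y := by
  have : 1 - y ≠ 0 := sub_ne_zero.mpr hy.symm
  rw [thetaAppell, mul_sub, thetaProd]
  field_simp
  ring

theorem differentiableAt_thetaAppell {p z y : ℂ} (hp0 : p ≠ 0) (hp : ‖p‖ < 1) (hz : z ≠ 0)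
    (h1 : ‖p‖ < ‖y‖) (h2 : ‖p‖ * ‖y‖ < 1) : DifferentiableAt ℂ (thetaAppell p z) y := by
  have hy : y ≠ 0 := norm_pos_iff.mp ((norm_nonneg p).trans_lt h1)
  exact (differentiableAt_thetaReg hp hy).add
    ((differentiableAt_thetaProd hp hy).mul (differentiableAt_appellSum_sub hp0 hp hz h1 h2))

theorem thetaAppellPair_eq (p : ℂ) {a x : ℂ} (h1 : x * a ≠ 1) (h2 : x * a⁻¹ ≠ 1) :
    thetaAppellPair p a x = thetaProd p (x * a) * thetaProd p (x * a⁻¹) * appellPair p a x := by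
  rw [thetaAppellPair, thetaAppell_of_ne_one p _ h1, thetaAppell_of_ne_one p _ h2, appellPair]
  ring

/-- The annulus of x is chosen so that xa and x/a both stay where `thetaAppell` is holomorphic. -/
theorem annulus_mul_bounds {p a x : ℂ} (hp0 : p ≠ 0) (ha0 : a ≠ 0) (ha : ‖a‖ < 1)
    (hx : ‖p‖ / ‖a‖ < ‖x‖ ∧ ‖x‖ < ‖a‖ / ‖p‖) :
    (‖p‖ < ‖x * a‖ ∧ ‖p‖ * ‖x * a‖ < 1) ∧ (‖p‖ < ‖x * a⁻¹‖ ∧ ‖p‖ * ‖x * a⁻¹‖ < 1) := by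
  have hp' : 0 < ‖p‖ := norm_pos_iff.mpr hp0
  have ha' : 0 < ‖a‖ := norm_pos_iff.mpr ha0
  obtain ⟨h1, h2⟩ := hx
  rw [div_lt_iff₀ ha'] at h1
  rw [lt_div_iff₀ hp'] at h2
  have hx' : 0 < ‖x‖ := pos_of_mul_pos_left (hp'.trans h1) ha'.le
  rw [norm_mul, norm_mul, norm_inv, ← div_eq_mul_inv, mul_div_assoc', div_lt_one ha',
    lt_div_iff₀ ha']
  refine ⟨⟨h1, ?_⟩, ?_, by linarith⟩
  · calc ‖p‖ * (‖x‖ * ‖a‖) = ‖x‖ * ‖p‖ * ‖a‖ := by ring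
      _ < 1 * 1 := mul_lt_mul'' (h2.trans ha) ha (by positivity) ha'.le
      _ = 1 := one_mul 1
  · nlinarith

theorem differentiableAt_thetaAppellPair {p a x : ℂ} (hp0 : p ≠ 0) (ha0 : a ≠ 0)
    (hpa : ‖p‖ < ‖a‖ ^ 2) (ha : ‖a‖ < 1) (hx : ‖p‖ / ‖a‖ < ‖x‖ ∧ ‖x‖ < ‖a‖ / ‖p‖) :
    DifferentiableAt ℂ (thetaAppellPair p a) x := by
  have hp : ‖p‖ < 1 := hpa.trans (pow_lt_one₀ (norm_nonneg a) ha two_ne_zero)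
  obtain ⟨⟨h1, h2⟩, h3, h4⟩ := annulus_mul_bounds hp0 ha0 ha hx
  have hn1 : x * a ≠ 0 := norm_pos_iff.mp ((norm_nonneg p).trans_lt h1)
  have hn2 : x * a⁻¹ ≠ 0 := norm_pos_iff.mp ((norm_nonneg p).trans_lt h3)
  have d1 : DifferentiableAt ℂ (fun x => x * a) x := by fun_prop
  have d2 : DifferentiableAt ℂ (fun x => x * a⁻¹) x := by fun_prop
  have e1 : DifferentiableAt ℂ (fun x => thetaProd p (x * a)) x :=
    (differentiableAt_thetaProd hp hn1).comp (f := fun x => x * a) x d1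
  have e2 : DifferentiableAt ℂ (fun x => thetaProd p (x * a⁻¹)) x :=
    (differentiableAt_thetaProd hp hn2).comp (f := fun x => x * a⁻¹) x d2
  have e3 : DifferentiableAt ℂ (fun x => thetaAppell p a (x * a)) x :=
    (differentiableAt_thetaAppell hp0 hp ha0 h1 h2).comp (f := fun x => x * a) x d1
  have e4 : DifferentiableAt ℂ (fun x => thetaAppell p a⁻¹ (x * a⁻¹)) x :=
    (differentiableAt_thetaAppell hp0 hp (inv_ne_zero ha0) h3 h4).comp (f := fun x => x * a⁻¹) x d2
  exact ((e1.const_mul a).mul e4).add (e2.mul e3)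

theorem appellPair_mul {p a x : ℂ} (hp0 : p ≠ 0) (ha0 : a ≠ 0) (hpa : ‖p‖ < ‖a‖ ^ 2)
    (ha : ‖a‖ < 1) (h1 : 1 < ‖x‖ * ‖a‖) (h2 : ‖x‖ * ‖p‖ < ‖a‖) :
    appellPair p a (p * x) = -(p * x) * appellPair p a x := by
  have hp : ‖p‖ < 1 := hpa.trans (pow_lt_one₀ (norm_nonneg a) ha two_ne_zero)
  have hp' : 0 < ‖p‖ := norm_pos_iff.mpr hp0
  have ha' : 0 < ‖a‖ := norm_pos_iff.mpr ha0
  have hx : ‖p‖ / ‖a‖ < ‖x‖ ∧ ‖x‖ < ‖a‖ / ‖p‖ := by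
    rw [div_lt_iff₀ ha', lt_div_iff₀ hp']
    exact ⟨hp.trans h1, h2⟩
  obtain ⟨⟨-, h3⟩, -, h4⟩ := annulus_mul_bounds hp0 ha0 ha hx
  have h5 : 1 < ‖x * a‖ := by rwa [norm_mul]
  have h6 : 1 < ‖x * a⁻¹‖ := by
    rw [norm_mul, norm_inv, ← div_eq_mul_inv, lt_div_iff₀ ha']
    nlinarith [norm_nonneg x]
  have ht := tsum_thetaTerm_inv hp0 ha0
  rw [appellPair, appellPair, mul_assoc p, mul_assoc p,
    appellSum_mul_right hp0 hp ha0 h5 h3, appellSum_mul_right hp0 hp (inv_ne_zero ha0) h6 h4,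
    mul_sub, ht]
  field_simp
  ring

/-- A combination of two Appell–Lerch series is proportional to a theta product. -/
theorem exists_thetaAppellPair_eq {p a : ℂ} (hp0 : p ≠ 0) (ha0 : a ≠ 0) (hpa : ‖p‖ < ‖a‖ ^ 2)
    (ha : ‖a‖ < 1) : ∃ c : ℂ, ∀ x : ℂ, ‖p‖ / ‖a‖ < ‖x‖ ∧ ‖x‖ < ‖a‖ / ‖p‖ →
      thetaAppellPair p a x = c * (x * thetaProd p x) := by
  have hp : ‖p‖ < 1 := hpa.trans (pow_lt_one₀ (norm_nonneg a) ha two_ne_zero)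
  have hp' : 0 < ‖p‖ := norm_pos_iff.mpr hp0
  have ha' : 0 < ‖a‖ := norm_pos_iff.mpr ha0
  have hpa1 : ‖p‖ < ‖a‖ := by nlinarith
  have ha1 : a ≠ 1 := by
    rintro rfl
    simp at ha
  set U : Set ℂ := {x | ‖p‖ / ‖a‖ < ‖x‖ ∧ ‖x‖ < ‖a‖ / ‖p‖} with hU
  have h1U : (1 : ℂ) ∈ U := by
    simp only [hU, mem_ofPred_eq, norm_one]
    rw [div_lt_one ha', one_lt_div hp']
    exact ⟨hpa1, hpa1⟩
  have hbd : ∀ x ∈ U, ‖p‖ < ‖x‖ ∧ ‖p‖ * ‖x‖ < 1 := by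
    rintro x ⟨h1, h2⟩
    rw [div_lt_iff₀ ha'] at h1
    rw [lt_div_iff₀ hp'] at h2
    exact ⟨by nlinarith [norm_nonneg x], by linarith⟩
  have hone : thetaAppellPair p a 1 = 0 := by
    have h := mul_appellSum_inv_self hp0 hp hpa1 ha
    rw [thetaAppellPair_eq p (by simpa using ha1) (by simpa using ha1), appellPair, one_mul,
      one_mul, h]
    ring
  have hE : DifferentiableOn ℂ (thetaAppellPair p a) U := fun x hx =>
    (differentiableAt_thetaAppellPair hp0 ha0 hpa ha hx).differentiableWithinAt
  have hUn : U ∈ 𝓝 (1 : ℂ) := (isOpen_annulus _ _).mem_nhds h1U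
  have hne : ∀ x ∈ U, x * thetaReg p x ≠ 0 := fun x hx =>
    mul_ne_zero (norm_pos_iff.mp ((norm_nonneg p).trans_lt (hbd x hx).1))
      (thetaReg_ne_zero hp (hbd x hx).1 (hbd x hx).2)
  -- `dslope` divides out the zero at x = 1, matching the factor 1 - x of the theta product up to
  -- sign.
  set h : ℂ → ℂ := fun x => dslope (thetaAppellPair p a) 1 x / (x * thetaReg p x) with hh
  have hdiff : DifferentiableOn ℂ h U := by
    refine ((Complex.differentiableOn_dslope hUn).mpr hE).div (fun x hx => ?_) hne
    have hx0 : x ≠ 0 := norm_pos_iff.mp ((norm_nonneg p).trans_lt (hbd x hx).1)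
    exact (differentiableAt_id.mul (differentiableAt_thetaReg hp hx0)).differentiableWithinAt
  have hval : ∀ x ∈ U, thetaAppellPair p a x = -h x * (x * thetaProd p x) := by
    intro x hx
    have h0 := hne x hx
    have h1 := sub_smul_dslope (thetaAppellPair p a) 1 x
    rw [hone, sub_zero, smul_eq_mul] at h1
    rw [← h1, hh, thetaProd]
    have h2 : ∀ d : ℂ, (x - 1) * d = -(d / (x * thetaReg p x)) * ((1 - x) * (x * thetaReg p x)) := by
      intro d
      rw [neg_mul, mul_left_comm, div_mul_cancel₀ _ h0]
      ring
    rw [h2]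
    ring
  have hper : ∀ x, ‖p‖ / ‖a‖ < ‖p * x‖ → ‖x‖ < ‖a‖ / ‖p‖ → h (p * x) = h x := by
    intro x hx1 hx2
    have hx1' := hx1
    have hx2' := hx2
    rw [norm_mul, div_lt_iff₀ ha', mul_assoc, lt_mul_iff_one_lt_right hp'] at hx1'
    rw [lt_div_iff₀ hp'] at hx2'
    have hxn : 1 < ‖x‖ := by nlinarith [norm_nonneg x]
    have hxU : x ∈ U := ⟨((div_lt_one ha').mpr hpa1).trans hxn, hx2⟩
    have hpx : ‖p * x‖ < ‖a‖ := by rwa [norm_mul, mul_comm]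
    have hpxU : p * x ∈ U := by
      refine ⟨hx1, hpx.trans ?_⟩
      rw [lt_div_iff₀ hp']
      nlinarith
    have hx0 : x ≠ 0 := norm_pos_iff.mp (zero_lt_one.trans hxn)
    have hx_ne : x ≠ 1 := by
      rintro rfl
      simp at hxn
    have hpx_ne : ∀ y : ℂ, ‖y‖ < 1 → y ≠ 1 := by
      rintro y hy rfl
      simp at hy
    have hy_ne : ∀ y : ℂ, 1 < ‖y‖ → y ≠ 1 := by
      rintro y hy rfl
      simp at hy
    have n1 : x * a ≠ 1 := hy_ne _ (by rwa [norm_mul])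
    have n2 : x * a⁻¹ ≠ 1 := hy_ne _ (by
      rw [norm_mul, norm_inv, ← div_eq_mul_inv, lt_div_iff₀ ha']
      linarith)
    have n3 : p * x * a ≠ 1 := hpx_ne _ (by
      rw [norm_mul]
      nlinarith [norm_nonneg (p * x)])
    have n4 : p * x * a⁻¹ ≠ 1 := hpx_ne _ (by
      rwa [norm_mul, norm_inv, ← div_eq_mul_inv, div_lt_one ha'])
    have e1 := hval x hxU
    have e2 := hval (p * x) hpxU
    rw [thetaAppellPair_eq p n1 n2] at e1
    rw [thetaAppellPair_eq p n3 n4, appellPair_mul hp0 ha0 hpa ha hx1' hx2', mul_assoc p x a,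
      mul_assoc p x a⁻¹, thetaProd_mul hp0 hp (mul_ne_zero hx0 ha0),
      thetaProd_mul hp0 hp (mul_ne_zero hx0 (inv_ne_zero ha0)), thetaProd_mul hp0 hp hx0] at e2
    -- The multiplier -p/x is also that of x θ(x).
    have e3 : -(x * a)⁻¹ * thetaProd p (x * a) * (-(x * a⁻¹)⁻¹ * thetaProd p (x * a⁻¹)) *
        (-(p * x) * appellPair p a x) = -p * x⁻¹ *
        (thetaProd p (x * a) * thetaProd p (x * a⁻¹) * appellPair p a x) := by
      field_simp
    rw [e3, e1] at e2
    have hT : thetaProd p x ≠ 0 := thetaProd_ne_zero hp (hbd x hxU).1 (hbd x hxU).2 hx_ne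
    have e4 : h x * (p * thetaProd p x) = h (p * x) * (p * thetaProd p x) := by
      have l : -p * x⁻¹ * (-h x * (x * thetaProd p x)) = h x * (p * thetaProd p x) := by
        rw [show -p * x⁻¹ * (-h x * (x * thetaProd p x)) =
          h x * (p * thetaProd p x) * (x⁻¹ * x) by ring, inv_mul_cancel₀ hx0, mul_one]
      have r : -h (p * x) * (p * x * (-x⁻¹ * thetaProd p x)) =
          h (p * x) * (p * thetaProd p x) := by
        rw [show -h (p * x) * (p * x * (-x⁻¹ * thetaProd p x)) =
          h (p * x) * (p * thetaProd p x) * (x⁻¹ * x) by ring, inv_mul_cancel₀ hx0, mul_one]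
      rw [← l, ← r, e2]
    exact (mul_right_cancel₀ (mul_ne_zero hp0 hT) e4).symm
  refine ⟨-h 1, fun x hx => ?_⟩
  rw [hval x hx]
  have hconst := eq_of_differentiableOn_annulus_of_periodic (div_pos hp' ha') hp0 hp
    (by
      rw [mul_div_cancel₀ _ hp'.ne', div_lt_iff₀ ha']
      nlinarith)
    (by
      rw [le_div_iff₀ ha', show ‖p‖ ^ 2 * (‖a‖ / ‖p‖) * ‖a‖ = ‖p‖ * ‖a‖ ^ 2 by field_simp]
      exact mul_le_of_le_one_right hp'.le (pow_le_one₀ ha'.le ha.le))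
    hdiff hper hx h1U
  rw [hconst]

/-- The difference of two Appell–Lerch series as a theta quotient. -/
theorem appellPair_mul_thetaProd {p a x : ℂ} (hp0 : p ≠ 0) (ha0 : a ≠ 0) (hpa : ‖p‖ < ‖a‖ ^ 2)
    (ha : ‖a‖ < 1) (hx : ‖p‖ / ‖a‖ < ‖x‖ ∧ ‖x‖ < ‖a‖ / ‖p‖) (h1 : x * a ≠ 1) (h2 : x * a⁻¹ ≠ 1) :
    appellPair p a x * (thetaProd p a * thetaProd p (x * a) * thetaProd p (x * a⁻¹)) =
      x * thetaProd p x * thetaProd p (a ^ 2) * qPochInf p p ^ 3 := by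
  have hp : ‖p‖ < 1 := hpa.trans (pow_lt_one₀ (norm_nonneg a) ha two_ne_zero)
  have hp' : 0 < ‖p‖ := norm_pos_iff.mpr hp0
  have ha' : 0 < ‖a‖ := norm_pos_iff.mpr ha0
  obtain ⟨c, hc⟩ := exists_thetaAppellPair_eq hp0 ha0 hpa ha
  -- At x = 1/a the second summand loses its factor θ(x/a) to θ(a⁻²), and the first vanishes with
  -- θ(1).
  have hi := hc a⁻¹ (by
    rw [norm_inv, div_lt_iff₀ ha', inv_mul_cancel₀ ha'.ne', lt_div_iff₀ hp', inv_mul_lt_iff₀ ha',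
      ← sq]
    exact ⟨hp, hpa⟩)
  rw [thetaAppellPair, inv_mul_cancel₀ ha0, thetaProd_one, thetaAppell_one, ← sq, inv_pow,
    thetaProd_inv p (pow_ne_zero 2 ha0), thetaProd_inv p ha0] at hi
  have hcc : thetaProd p (a ^ 2) * qPochInf p p ^ 3 = c * thetaProd p a := by
    field_simp at hi
    linear_combination -hi
  have hxx := hc x hx
  rw [thetaAppellPair_eq p h1 h2] at hxx
  linear_combination thetaProd p a * hxx - x * thetaProd p x * hcc

/-! ### Specialization to p = q⁵ -/

/-- With these parameters half the quadratic is the integer 5·m(m - 1)/2 + dm + e. -/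
theorem lambertTerm_eq {q : ℂ} (hq : q ≠ 0) (d e c m : ℤ) :
    lambertTerm (2 * d - 5) (2 * e) c q m = q ^ e * appellTerm (q ^ 5) (q ^ d) (q ^ c) m := by
  obtain ⟨k, hk⟩ := Int.even_mul_pred_self m
  have h1 : m * (m - 1) / 2 = k := by omega
  have h2 : (5 * m ^ 2 + (2 * d - 5) * m + 2 * e) / 2 = 5 * k + d * m + e := by
    have : 5 * m ^ 2 + (2 * d - 5) * m + 2 * e = 2 * (5 * k + d * m + e) := by
      linear_combination 5 * hk
    omega
  have h3 : (q ^ 5) ^ k = q ^ (5 * k) := by rw [zpow_mul]; norm_cast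
  have h4 : (q ^ 5) ^ m = q ^ (5 * m) := by rw [zpow_mul]; norm_cast
  rw [lambertTerm, appellTerm, thetaTerm, h1, h2, h3, h4, ← zpow_mul, zpow_add₀ hq, zpow_add₀ hq,
    zpow_add₀ hq]
  ring

theorem norm_zpow_lt_norm_zpow {q : ℂ} (hq0 : q ≠ 0) (hq1 : ‖q‖ < 1) {m n : ℤ} (h : n < m) :
    ‖q ^ m‖ < ‖q ^ n‖ := by
  rw [norm_zpow, norm_zpow]
  exact zpow_right_strictAnti₀ (norm_pos_iff.mpr hq0) hq1 h

theorem zpow_ne_one_of_norm_lt_one {q : ℂ} (hq0 : q ≠ 0) (hq1 : ‖q‖ < 1) {m : ℤ} (h : m ≠ 0) :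
    q ^ m ≠ 1 := by
  intro hm
  rcases lt_or_gt_of_ne h with h | h <;>
    · have := norm_zpow_lt_norm_zpow hq0 hq1 h
      rw [hm, zpow_zero] at this
      exact this.false

theorem thetaProd_pow_five {q : ℂ} (hq0 : q ≠ 0) (hq1 : ‖q‖ < 1) {i j : ℕ} (h : i + j = 5) :
    thetaProd (q ^ 5) (q ^ i) =
      qPochInf (q ^ 5) (q ^ 5) * (qPochInf (q ^ i) (q ^ 5) * qPochInf (q ^ j) (q ^ 5)) := by
  have hp : ‖q ^ 5‖ < 1 := by
    rw [norm_pow]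
    exact pow_lt_one₀ (norm_nonneg q) hq1 (by norm_num)
  have h1 : q ^ 5 * (q ^ i)⁻¹ = q ^ j := by
    rw [← h, pow_add, mul_right_comm, mul_inv_cancel₀ (pow_ne_zero i hq0), one_mul]
  rw [thetaProd_eq hp, h1, mul_assoc]

theorem summable_lambertTerm {q : ℂ} (hq0 : q ≠ 0) (hq1 : ‖q‖ < 1) (d e c : ℤ) (h1 : -5 < c)
    (h2 : c < 5) : Summable (lambertTerm (2 * d - 5) (2 * e) c q) := by
  simp_rw [funext fun m => lambertTerm_eq hq0 d e c m]
  have hp : ‖q ^ 5‖ < 1 := by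
    rw [norm_pow]
    exact pow_lt_one₀ (norm_nonneg q) hq1 (by norm_num)
  refine (summable_appellTerm (pow_ne_zero 5 hq0) hp (zpow_ne_zero d hq0) ?_ ?_).mul_left _
  · exact norm_zpow_lt_norm_zpow hq0 hq1 (m := 5) h2
  · rw [← norm_mul, ← zpow_natCast, ← zpow_add₀ hq0]
    simpa using norm_zpow_lt_norm_zpow hq0 hq1 (m := 5 + c) (n := 0) (by omega)

theorem tsum_lambertTerm {q : ℂ} (hq0 : q ≠ 0) (d e c : ℤ) :
    ∑' m, lambertTerm (2 * d - 5) (2 * e) c q m =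
      q ^ e * appellSum (q ^ 5) (q ^ d) (q ^ c) := by
  rw [appellSum, ← tsum_mul_left]
  exact tsum_congr fun m => lambertTerm_eq hq0 d e c m

theorem appellSum_sub_mul_thetaProd_sq {q : ℂ} (hq0 : q ≠ 0) (hq1 : ‖q‖ < 1) :
    (appellSum (q ^ 5) (q ^ 4) q - appellSum (q ^ 5) q (q ^ (-2 : ℤ))) *
      thetaProd (q ^ 5) q ^ 2 = thetaProd (q ^ 5) (q ^ 2) * qPochInf (q ^ 5) (q ^ 5) ^ 3 := by
  have hp0 : q ^ 5 ≠ 0 := pow_ne_zero 5 hq0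
  have hq' : 0 < ‖q‖ := norm_pos_iff.mpr hq0
  have hp : ‖q ^ 5‖ < 1 := by
    rw [norm_pow]
    exact pow_lt_one₀ hq'.le hq1 (by norm_num)
  have lt := fun {m n : ℤ} (h : n < m) => norm_zpow_lt_norm_zpow hq0 hq1 h
  -- Here a = q, so xa = q⁻² and x/a = q⁻⁴; shifting the index by one (`s1`) moves q⁻⁴ to q.
  have key := appellPair_mul_thetaProd (x := q ^ (-3 : ℤ)) hp0 hq0
    (by rw [← norm_pow]; exact lt (m := 5) (n := 2) (by norm_num)) hq1
    (by
      rw [← norm_div, ← norm_div, show q ^ 5 / q = q ^ (4 : ℤ) by field_simp,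
        show q / q ^ 5 = q ^ (-4 : ℤ) by field_simp]
      exact ⟨lt (by norm_num), lt (by norm_num)⟩)
    (by
      rw [← zpow_add_one₀ hq0]
      exact zpow_ne_one_of_norm_lt_one hq0 hq1 (by norm_num))
    (by
      rw [← zpow_sub_one₀ hq0]
      exact zpow_ne_one_of_norm_lt_one hq0 hq1 (by norm_num))
  have e1 : q ^ (-3 : ℤ) * q = q ^ (-2 : ℤ) := by rw [← zpow_add_one₀ hq0]; norm_num
  have e2 : q ^ (-3 : ℤ) * q⁻¹ = q ^ (-4 : ℤ) := by rw [← zpow_sub_one₀ hq0]; norm_num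
  have e3 : q ^ 4 = q ^ 5 * q⁻¹ := by field_simp
  have e4 : q = q ^ 5 * q ^ (-4 : ℤ) := by
    rw [zpow_neg]
    norm_cast
    field_simp
  have e5 : q ^ 3 = q ^ 5 * (q ^ 2)⁻¹ := by field_simp
  have s1 : appellSum (q ^ 5) (q ^ 4) q = -q * appellSum (q ^ 5) q⁻¹ (q ^ (-4 : ℤ)) := by
    have := appellSum_mul_mul hp0 (inv_ne_zero hq0) (q ^ (-4 : ℤ))
    rwa [← e3, ← e4, inv_inv] at this
  have t2 : thetaProd (q ^ 5) (q ^ (-2 : ℤ)) = -(q ^ 2)⁻¹ * thetaProd (q ^ 5) (q ^ 2) :=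
    thetaProd_inv _ (pow_ne_zero 2 hq0)
  have t3 : thetaProd (q ^ 5) (q ^ (-3 : ℤ)) = -(q ^ 3)⁻¹ * thetaProd (q ^ 5) (q ^ 2) := by
    rw [← thetaProd_mul_inv hp0 hp (pow_ne_zero 2 hq0), ← e5]
    exact thetaProd_inv _ (pow_ne_zero 3 hq0)
  have t4 : thetaProd (q ^ 5) (q ^ (-4 : ℤ)) = -(q ^ 4)⁻¹ * thetaProd (q ^ 5) q := by
    rw [← thetaProd_mul_inv hp0 hp hq0, ← e3]
    exact thetaProd_inv _ (pow_ne_zero 4 hq0)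
  -- Both sides of `key` carry a factor θ(q²), to be cancelled.
  have hT : thetaProd (q ^ 5) (q ^ 2) ≠ 0 := by
    refine thetaProd_ne_zero hp (lt (m := 5) (n := 2) (by norm_num)) ?_
      (zpow_ne_one_of_norm_lt_one hq0 hq1 (m := 2) (by norm_num))
    rw [← norm_mul, ← pow_add]
    simpa using lt (m := 7) (n := 0) (by norm_num)
  have e6 : q ^ (-3 : ℤ) = (q ^ 3)⁻¹ := zpow_neg q 3
  rw [e1, e2, appellPair, e1, e2, t2, t3, t4, e6] at key
  rw [s1]
  generalize appellSum (q ^ 5) q⁻¹ (q ^ (-4 : ℤ)) = A at key ⊢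
  generalize appellSum (q ^ 5) q (q ^ (-2 : ℤ)) = B at key ⊢
  field_simp at key
  linear_combination -key

theorem appellSum_sub_mul_thetaProd_sq' {q : ℂ} (hq0 : q ≠ 0) (hq1 : ‖q‖ < 1) :
    (appellSum (q ^ 5) (q ^ 2) (q ^ (-2 : ℤ)) - appellSum (q ^ 5) (q ^ 3) q⁻¹) *
      thetaProd (q ^ 5) (q ^ 2) ^ 2 =
        q * thetaProd (q ^ 5) q * qPochInf (q ^ 5) (q ^ 5) ^ 3 := by
  have hp0 : q ^ 5 ≠ 0 := pow_ne_zero 5 hq0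
  have hq2 : q ^ 2 ≠ 0 := pow_ne_zero 2 hq0
  have hq' : 0 < ‖q‖ := norm_pos_iff.mpr hq0
  have hp : ‖q ^ 5‖ < 1 := by
    rw [norm_pow]
    exact pow_lt_one₀ hq'.le hq1 (by norm_num)
  have lt := fun {m n : ℤ} (h : n < m) => norm_zpow_lt_norm_zpow hq0 hq1 h
  have e1 : q * q ^ 2 = q ^ 3 := by ring
  have e2 : q * (q ^ 2)⁻¹ = q⁻¹ := by field_simp
  have e3 : q ^ 4 = q ^ 5 * q⁻¹ := by field_simp
  have e4 : q ^ 3 = q ^ 5 * q ^ (-2 : ℤ) := by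
    rw [zpow_neg]
    norm_cast
    field_simp
  have e5 : q ^ 3 = q ^ 5 * (q ^ 2)⁻¹ := by field_simp
  have ne_one := fun {m : ℤ} (h : m ≠ 0) => zpow_ne_one_of_norm_lt_one hq0 hq1 h
  have hq_ne : q⁻¹ ≠ 1 := by simpa using ne_one (m := -1) (by norm_num)
  -- Here a = q², so xa = q³ and x/a = q⁻¹; `s1` and `s2` bring in theta series, which `s3` cancels.
  have key := appellPair_mul_thetaProd (x := q) hp0 hq2
    (by rw [← norm_pow, ← pow_mul]; exact lt (m := 5) (n := 4) (by norm_num))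
    (by simpa using lt (m := 2) (n := 0) (by norm_num))
    (by
      rw [← norm_div, ← norm_div, show q ^ 5 / q ^ 2 = q ^ (3 : ℤ) by field_simp,
        show q ^ 2 / q ^ 5 = q ^ (-3 : ℤ) by field_simp]
      exact ⟨by simpa using lt (m := 3) (n := 1) (by norm_num),
        by simpa using lt (m := 1) (n := -3) (by norm_num)⟩)
    (by rw [e1]; exact ne_one (m := 3) (by norm_num))
    (by rwa [e2])
  have s1 : appellSum (q ^ 5) (q ^ 2) (q ^ 3) = ∑' r, thetaTerm (q ^ 5) (q ^ 2) r -
      q ^ 3 * (q ^ 2)⁻¹ * appellSum (q ^ 5) (q ^ 2) (q ^ (-2 : ℤ)) := by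
    have := appellSum_mul_right (y := q ^ (-2 : ℤ)) hp0 hp hq2
      (by simpa using lt (m := 0) (n := -2) (by norm_num))
      (by
        rw [← norm_mul, ← e4]
        simpa using lt (m := 3) (n := 0) (by norm_num))
    rwa [← e4] at this
  have s2 : appellSum (q ^ 5) (q ^ 2)⁻¹ q⁻¹ = ∑' r, thetaTerm (q ^ 5) (q ^ 2)⁻¹ r +
      q⁻¹ * appellSum (q ^ 5) (q ^ 3) q⁻¹ := by
    rw [e5]
    refine appellSum_eq_tsum_add hp0 hp (inv_ne_zero hq2) ?_ ?_ hq_ne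
    · simpa using lt (m := 5) (n := -1) (by norm_num)
    · rw [← norm_mul, show q ^ 5 * q⁻¹ = q ^ 4 by field_simp]
      simpa using lt (m := 4) (n := 0) (by norm_num)
  have s3 := tsum_thetaTerm_inv hp0 hq2
  have t3 : thetaProd (q ^ 5) (q ^ 3) = thetaProd (q ^ 5) (q ^ 2) := by
    rw [e5, thetaProd_mul_inv hp0 hp hq2]
  have t4 : thetaProd (q ^ 5) (q ^ 4) = thetaProd (q ^ 5) q := by
    rw [e3, thetaProd_mul_inv hp0 hp hq0]
  have hT : thetaProd (q ^ 5) q ≠ 0 := by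
    refine thetaProd_ne_zero hp (by simpa using lt (m := 5) (n := 1) (by norm_num)) ?_
      (by simpa using ne_one (m := 1) (by norm_num))
    rw [← norm_mul, ← pow_succ]
    simpa using lt (m := 6) (n := 0) (by norm_num)
  have hpair : appellPair (q ^ 5) (q ^ 2) q = -q *
      (appellSum (q ^ 5) (q ^ 2) (q ^ (-2 : ℤ)) - appellSum (q ^ 5) (q ^ 3) q⁻¹) := by
    rw [appellPair, e1, e2, s1, s2, mul_add, s3]
    field_simp
    ring
  rw [hpair, e1, e2, t3, thetaProd_inv _ hq0, ← pow_mul, t4] at key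
  generalize appellSum (q ^ 5) (q ^ 2) (q ^ (-2 : ℤ)) -
    appellSum (q ^ 5) (q ^ 3) q⁻¹ = D at key ⊢
  field_simp at key
  exact key

theorem theorem4p4 (q : ℂ) (hq0 : q ≠ 0) (hq1 : ‖q‖ < 1) :
    (Summable (lambertTerm 3 0 1 q) ∧ Summable (lambertTerm (-3) 0 (-2) q) ∧
      ∑' m : ℤ, lambertTerm 3 0 1 q m - ∑' m : ℤ, lambertTerm (-3) 0 (-2) q m =
        qPochInf (q ^ 5) (q ^ 5) ^ 2 * (rrG q ^ 2 / rrH q)) ∧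
    (Summable (lambertTerm (-1) (-2) (-2) q) ∧ Summable (lambertTerm 1 (-2) (-1) q) ∧
      ∑' m : ℤ, lambertTerm (-1) (-2) (-2) q m - ∑' m : ℤ, lambertTerm 1 (-2) (-1) q m =
        qPochInf (q ^ 5) (q ^ 5) ^ 2 * (rrH q ^ 2 / rrG q)) := by
  have hp : ‖q ^ 5‖ < 1 := by
    rw [norm_pow]
    exact pow_lt_one₀ (norm_nonneg q) hq1 (by norm_num)
  have hne : ∀ i : ℕ, i ≠ 0 → qPochInf (q ^ i) (q ^ 5) ≠ 0 := fun i hi =>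
    qPochInf_ne_zero_of_norm_lt_one hp (by
      rw [norm_pow]
      exact pow_lt_one₀ (norm_nonneg q) hq1 hi)
  have h1 : qPochInf q (q ^ 5) ≠ 0 := by simpa using hne 1
  have h2 := hne 2 (by norm_num)
  have h3 := hne 3 (by norm_num)
  have h4 := hne 4 (by norm_num)
  have h5 := hne 5 (by norm_num)
  have j1 : thetaProd (q ^ 5) q = qPochInf (q ^ 5) (q ^ 5) *
      (qPochInf q (q ^ 5) * qPochInf (q ^ 4) (q ^ 5)) := by
    simpa using thetaProd_pow_five hq0 hq1 (i := 1) (j := 4) rfl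
  have j2 := thetaProd_pow_five hq0 hq1 (i := 2) (j := 3) rfl
  have i1 := appellSum_sub_mul_thetaProd_sq hq0 hq1
  have i2 := appellSum_sub_mul_thetaProd_sq' hq0 hq1
  rw [j1, j2] at i1 i2
  -- The linear coefficients 3, -3, -1, 1 are 2d - 5 for d = 4, 1, 2, 3. Over ℂ, `Summable` amounts
  -- to absolute convergence.
  refine ⟨⟨summable_lambertTerm hq0 hq1 4 0 1 (by norm_num) (by norm_num),
    summable_lambertTerm hq0 hq1 1 0 (-2) (by norm_num) (by norm_num), ?_⟩,
    summable_lambertTerm hq0 hq1 2 (-1) (-2) (by norm_num) (by norm_num),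
    summable_lambertTerm hq0 hq1 3 (-1) (-1) (by norm_num) (by norm_num), ?_⟩
  · have l1 := tsum_lambertTerm hq0 4 0 1
    have l2 := tsum_lambertTerm hq0 1 0 (-2)
    norm_num only [zpow_zero, one_mul, zpow_one] at l1 l2
    rw [l1, l2, rrG, rrH]
    norm_cast at i1 ⊢
    field_simp
    field_simp at i1
    linear_combination i1
  · have l1 := tsum_lambertTerm hq0 2 (-1) (-2)
    have l2 := tsum_lambertTerm hq0 3 (-1) (-1)
    norm_num only [zpow_neg_one] at l1 l2
    rw [l1, l2, rrG, rrH]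
    norm_cast at i2 ⊢
    field_simp
    field_simp at i2
    linear_combination i2
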